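/- For each $n\ge 1$ let $\mathbf H_n$ be a random $n\times n$ matrix with i.i.d. circularly symmetric complex Gaussian $\mathcal{CN}(0,1/n)$ entries, all $\mathbf H_n$ being defined on one probability space (with an arbitrary joint law), and let $R_{1,1}\ge\dots\ge R_{n,n}\ge 0$ be the singular values of $\mathbf H_n$. Let the total power $P=P_n>0$ and the noise variance $\sigma^2=\sigma_n^2>0$ be such that $\mathsf{SNR}=P_n/\sigma_n^2$ does not depend on $n$, and put $\eta_i=\sigma^2/(nR_{i,i}^2)$ for $1\le i\le n$. For each $n$ let $M_1,\dots,M_n\in\{4,4^2,4^3,\dots\}$ be QAM constellation sizes, which may depend on $n$ and on the channel realization. The mercury/waterfilling (MWF) power allocation is, with $(x)_+=\max\{0,x\}$, $$p_i=\frac{\eta_i}{2}\left(\sqrt{(M_i-1)^2+\frac{4}{\eta_i\lambda_{\mathsf{MWF}}}(M_i-1)}-M_i-1\right)_+,\qquad 1\le i\le n,$$ where the Lagrange multiplier $\lambda_{\mathsf{MWF}}>0$ is the solution of $\sum_{i=1}^n p_i(\lambda_{\mathsf{MWF}})=P$. Let $k_{\mathrm{opt}}=\sum_{i=1}^n 1_{\{p_i=0\}}$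 be the number of subchannels that are switched off. Then, almost surely, the multiplier $\lambda_{\mathsf{MWF}}$ exists and is unique for every $n\ge 1$, and the limit $\lim_{n\to\infty}k_{\mathrm{opt}}$ exists in $\{0,1,2,\dots\}\cup\{\infty\}$ and satisfies $$\lim_{n\to\infty}k_{\mathrm{opt}}>0 .$$ -/

import Mathlib

open MeasureTheory ProbabilityTheory Filter Topology
open scoped NNReal

/-- The circularly symmetric complex Gaussian law `𝒞𝒩(0, v)`: real and imaginary parts are
independent, each real Gaussian with mean `0` and variance `v / 2`. -/
noncomputable def complexGaussian (v : ℝ≥0) : Measure ℂ :=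
  ((gaussianReal 0 (v / 2)).prod (gaussianReal 0 (v / 2))).map (fun p : ℝ × ℝ => (⟨p.1, p.2⟩ : ℂ))

/-- `H` is an `n × n` complex Gaussian random matrix: its entries are independent, each with
law `𝒞𝒩(0, 1/n)`. -/
structure IsComplexGaussianMatrix {Ω : Type*} [MeasurableSpace Ω] {n : ℕ}
    (H : Ω → Matrix (Fin n) (Fin n) ℂ) (μ : Measure Ω) : Prop where
  hasLaw : ∀ i j, HasLaw (fun ω => H ω i j) (complexGaussian (1 / (n : ℝ≥0))) μ
  indep : iIndepFun (fun (q : Fin n × Fin n) ω => H ω q.1 q.2) μ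

/-- The singular values `R i` of `A`, in nonincreasing order (indexed from `0`, so the last index
is the weakest subchannel). -/
noncomputable def singularValue {n : ℕ} (A : Matrix (Fin n) (Fin n) ℂ) (i : Fin n) : ℝ :=
  (Matrix.toEuclideanLin A).singularValues i

/-- The normalized noise power `η i = σ² / (n * (R i)²)` of the `i`-th subchannel; the argument
`noiseVar` is the noise variance `σ²`. -/
noncomputable def normalizedNoise {n : ℕ} (noiseVar : ℝ) (A : Matrix (Fin n) (Fin n) ℂ)
    (i : Fin n) : ℝ :=
  noiseVar / (n * singularValue A i ^ 2)

/-- The power that mercury/waterfilling gives to a subchannel with normalized noise power `η` and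
an `M`-point QAM constellation, for the Lagrange multiplier `lam`. -/
noncomputable def mwfPowerAt (η : ℝ) (M : ℕ) (lam : ℝ) : ℝ :=
  η / 2 * max 0 (√(((M : ℝ) - 1) ^ 2 + 4 / (η * lam) * ((M : ℝ) - 1)) - M - 1)

/-- `lam` is a Lagrange multiplier for total power `P`: it is positive and the powers it
determines add up to `P`. -/
def IsMWFMultiplier {n : ℕ} (P : ℝ) (η : Fin n → ℝ) (M : Fin n → ℕ) (lam : ℝ) : Prop :=
  0 < lam ∧ ∑ i, mwfPowerAt (η i) (M i) lam = P

open Classical in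
/-- The Lagrange multiplier of mercury/waterfilling (the junk value `0` if there is not exactly
one). -/
noncomputable def mwfMultiplier {n : ℕ} (P : ℝ) (η : Fin n → ℝ) (M : Fin n → ℕ) : ℝ :=
  if h : ∃! lam : ℝ, IsMWFMultiplier P η M lam then h.choose else 0

/-- The mercury/waterfilling power allocation. -/
noncomputable def mwfPower {n : ℕ} (P : ℝ) (η : Fin n → ℝ) (M : Fin n → ℕ) (i : Fin n) : ℝ :=
  mwfPowerAt (η i) (M i) (mwfMultiplier P η M)

/-- The number of inactive subchannels of a power allocation. -/
noncomputable def kOpt {n : ℕ} (p : Fin n → ℝ) : ℕ :=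
  Nat.card {i : Fin n // p i = 0}

/-!
Almost surely the number of switched-off subchannels tends to infinity, so that `⊤` is the limit.

Write `θ = σ² * lam / n` for the multiplier `lam`. Subchannel `i` is off as soon as
`(R i)² ≤ θ`, whatever its constellation, and the power of an active subchannel is smallest for
4-QAM (`le_mwfPowerAt`). Hence, if a fixed fraction of the `(R i)²` lies in a fixed interval
`[a, b]` with `a > 0`, then `θ` is bounded below by a constant depending on the signal-to-noise
ratio only: otherwise these subchannels would use more than the total power
(`exists_threshold_le_kOpt`). Two facts on the singular values remain; both have to hold with
summable failure probabilities, as the joint law of the matrices is arbitrary and only the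
Borel–Cantelli lemma is available.

* *A positive fraction of the singular values is of order one.* By a Paley–Zygmund argument it
  suffices that `∑ (R i)² ≥ n / 6` and `∑ (R i)⁴ ≤ 32 * n`. The two sums are the sum of the squared
  row norms and the sum of the squared moduli of the inner products of pairs of rows. Given row `k`,
  its inner products with the others are Gaussian and independent, and Chernoff bounds for sums of
  squared Gaussians control everything (`gaussianMatrix_compl_balancedRows`).
* *For every `K` and `c > 0`, at least `K` of the `(R i)²` are at most `c` for large `n`.* On a
  `K`-dimensional subspace orthogonal to the first `n - K` rows, only the last `K` rows act. They
  are independent of the subspace, so that the restriction is a `K × K` matrix with entries of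
  variance `1 / n`, which is small (`gaussianMatrix_compl_smallOnSubspace`). A dimension count turns
  this into a statement on singular values (`le_card_singularValue_sq_le`).
-/

/-! ### Mercury/waterfilling powers as functions of the multiplier -/

lemma mwfPowerAt_nonneg {η : ℝ} (hη : 0 ≤ η) (M : ℕ) (lam : ℝ) : 0 ≤ mwfPowerAt η M lam :=
  mul_nonneg (by linarith) (le_max_left _ _)

lemma mwfPowerAt_zero_noise (M : ℕ) (lam : ℝ) : mwfPowerAt 0 M lam = 0 := by
  simp [mwfPowerAt]

/-- A subchannel is switched off as soon as `η * lam ≥ 1`, whatever its constellation. -/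
lemma mwfPowerAt_eq_zero_of_one_le {η lam : ℝ} {M : ℕ} (hM : 1 ≤ M) (h : 1 ≤ η * lam) :
    mwfPowerAt η M lam = 0 := by
  have hM' : (1 : ℝ) ≤ M := by exact_mod_cast hM
  have h4 : 4 / (η * lam) ≤ 4 := by
    rw [div_le_iff₀ (by linarith)]
    linarith
  have hs : √(((M : ℝ) - 1) ^ 2 + 4 / (η * lam) * ((M : ℝ) - 1)) ≤ M + 1 := by
    refine Real.sqrt_le_iff.2 ⟨by linarith, ?_⟩
    nlinarith
  rw [mwfPowerAt, max_eq_left (by linarith), mul_zero]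

lemma mwfPowerAt_antitone {η lam₁ lam₂ : ℝ} {M : ℕ} (hη : 0 ≤ η) (hM : 1 ≤ M) (h₁ : 0 < lam₁)
    (h : lam₁ ≤ lam₂) : mwfPowerAt η M lam₂ ≤ mwfPowerAt η M lam₁ := by
  rcases hη.eq_or_lt with rfl | hη'
  · simp [mwfPowerAt_zero_noise]
  have hM' : (0 : ℝ) ≤ (M : ℝ) - 1 := by
    have : (1 : ℝ) ≤ M := by exact_mod_cast hM
    linarith
  unfold mwfPowerAt
  gcongr

/-- An active subchannel reacts strictly to a decrease of the multiplier. -/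
lemma mwfPowerAt_lt_of_pos {η lam₁ lam₂ : ℝ} {M : ℕ} (hη : 0 ≤ η) (hM : 2 ≤ M) (h₁ : 0 < lam₁)
    (h : lam₁ < lam₂) (hpos : 0 < mwfPowerAt η M lam₂) :
    mwfPowerAt η M lam₂ < mwfPowerAt η M lam₁ := by
  rcases hη.eq_or_lt with rfl | hη'
  · simp [mwfPowerAt_zero_noise] at hpos
  have hM' : (0 : ℝ) < (M : ℝ) - 1 := by
    have : (2 : ℝ) ≤ M := by exact_mod_cast hM
    linarith
  have hlt : √(((M : ℝ) - 1) ^ 2 + 4 / (η * lam₂) * ((M : ℝ) - 1)) <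
      √(((M : ℝ) - 1) ^ 2 + 4 / (η * lam₁) * ((M : ℝ) - 1)) := by
    have h₂ : 0 < lam₂ := h₁.trans h
    gcongr
  unfold mwfPowerAt at hpos ⊢
  have h0 : 0 < √(((M : ℝ) - 1) ^ 2 + 4 / (η * lam₂) * ((M : ℝ) - 1)) - M - 1 := by
    by_contra hneg
    rw [max_eq_left (not_lt.1 hneg), mul_zero] at hpos
    exact lt_irrefl _ hpos
  rw [max_eq_right h0.le]
  exact mul_lt_mul_of_pos_left (lt_max_of_lt_right (by linarith)) (by linarith)

lemma continuousOn_mwfPowerAt {η : ℝ} (hη : 0 ≤ η) (M : ℕ) :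
    ContinuousOn (mwfPowerAt η M) (Set.Ioi 0) := by
  rcases hη.eq_or_lt with rfl | hη'
  · exact continuousOn_const.congr fun lam _ => mwfPowerAt_zero_noise M lam
  unfold mwfPowerAt
  have : ContinuousOn (fun lam : ℝ => 4 / (η * lam)) (Set.Ioi 0) :=
    continuousOn_const.div (by fun_prop) fun lam hlam => (mul_pos hη' hlam).ne'
  fun_prop

/-- The power grows with the constellation, so that 4-QAM gives a lower bound for all of them. -/
lemma le_mwfPowerAt {η lam : ℝ} {M : ℕ} (hη : 0 ≤ η) (hlam : 0 < lam) (hM : 4 ≤ M) :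
    η / 2 * (√(9 + 12 / (η * lam)) - 5) ≤ mwfPowerAt η M lam := by
  unfold mwfPowerAt
  refine mul_le_mul_of_nonneg_left (le_max_of_le_right ?_) (by linarith)
  have hM' : (4 : ℝ) ≤ M := by exact_mod_cast hM
  have hy : 0 ≤ 1 / (η * lam) := by positivity
  rw [show 12 / (η * lam) = 12 * (1 / (η * lam)) by ring,
    show 4 / (η * lam) = 4 * (1 / (η * lam)) by ring]
  set y := 1 / (η * lam)
  have hu := Real.sq_sqrt (show 0 ≤ 9 + 12 * y by positivity)
  have hu3 : √(9 + 12 * y) ≤ 3 + 2 * y := Real.sqrt_le_iff.2 ⟨by positivity, by nlinarith⟩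
  have : √(9 + 12 * y) + (M - 4) ≤ √(((M : ℝ) - 1) ^ 2 + 4 * y * ((M : ℝ) - 1)) := by
    refine Real.le_sqrt_of_sq_le ?_
    nlinarith [mul_le_mul_of_nonneg_left hu3 (sub_nonneg.2 hM')]
  linarith

/-- Every active subchannel can be given as much power as desired. -/
lemma exists_le_mwfPowerAt {η : ℝ} {M : ℕ} (hη : 0 < η) (hM : 4 ≤ M) {P : ℝ} (hP : 0 < P) :
    ∃ lam, 0 < lam ∧ P ≤ mwfPowerAt η M lam := by
  have hc : 0 < 5 + 2 * P / η := by positivity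
  -- chosen so that `12 / (η * lam) = (5 + 2 * P / η) ^ 2`
  refine ⟨12 / (η * (5 + 2 * P / η) ^ 2), by positivity, ?_⟩
  refine le_trans ?_ (le_mwfPowerAt hη.le (by positivity) hM)
  have h1 : 12 / (η * (12 / (η * (5 + 2 * P / η) ^ 2))) = (5 + 2 * P / η) ^ 2 := by
    field_simp
  rw [h1]
  have h2 : 5 + 2 * P / η ≤ √(9 + (5 + 2 * P / η) ^ 2) := Real.le_sqrt_of_sq_le (by linarith)
  calc P = η / 2 * (5 + 2 * P / η - 5) := by field_simp; ring
    _ ≤ _ := by gcongr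

theorem existsUnique_isMWFMultiplier {n : ℕ} {P : ℝ} {η : Fin n → ℝ} {M : Fin n → ℕ}
    (hP : 0 < P) (hη : ∀ i, 0 ≤ η i) (hη' : ∃ i, 0 < η i) (hM : ∀ i, 4 ≤ M i) :
    ∃! lam, IsMWFMultiplier P η M lam := by
  obtain ⟨i₀, hi₀⟩ := hη'
  obtain ⟨a, ha, haP⟩ := exists_le_mwfPowerAt hi₀ (hM i₀) hP
  -- at the multiplier `b` every subchannel is switched off
  set b := a + ∑ i, 1 / η i with hb
  have hab : a ≤ b := by
    have : 0 ≤ ∑ i, 1 / η i := Finset.sum_nonneg fun i _ => one_div_nonneg.2 (hη i)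
    linarith
  have hfa : P ≤ ∑ i, mwfPowerAt (η i) (M i) a :=
    haP.trans (Finset.single_le_sum (f := fun i => mwfPowerAt (η i) (M i) a)
      (fun i _ => mwfPowerAt_nonneg (hη i) _ _) (Finset.mem_univ i₀))
  have hfb : ∑ i, mwfPowerAt (η i) (M i) b = 0 := by
    refine Finset.sum_eq_zero fun i _ => ?_
    rcases (hη i).eq_or_lt with h0 | h0
    · rw [← h0, mwfPowerAt_zero_noise]
    refine mwfPowerAt_eq_zero_of_one_le (by linarith [hM i]) ?_
    have : 1 / η i ≤ b := by
      have := Finset.single_le_sum (f := fun i => 1 / η i)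
        (fun i _ => one_div_nonneg.2 (hη i)) (Finset.mem_univ i)
      linarith
    rw [div_le_iff₀ h0] at this
    linarith
  have hcont : ContinuousOn (fun lam => ∑ i, mwfPowerAt (η i) (M i) lam) (Set.Icc a b) :=
    continuousOn_finsetSum _ fun i _ =>
      (continuousOn_mwfPowerAt (hη i) (M i)).mono fun x hx => lt_of_lt_of_le ha hx.1
  obtain ⟨lam, hlam, hsum⟩ := intermediate_value_Icc' hab hcont ⟨hfb.le.trans hP.le, hfa⟩
  -- two multipliers cannot be distinct, as some subchannel is active at the larger one
  have key : ∀ x y, IsMWFMultiplier P η M x → IsMWFMultiplier P η M y → ¬ x < y := by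
    rintro x y ⟨hx, hxP⟩ ⟨hy, hyP⟩ hxy
    obtain ⟨i, -, hi⟩ : ∃ i ∈ Finset.univ, 0 < mwfPowerAt (η i) (M i) y := by
      by_contra! hcon
      linarith [Finset.sum_nonpos hcon]
    have := Finset.sum_lt_sum (s := Finset.univ) (f := fun i => mwfPowerAt (η i) (M i) y)
      (g := fun i => mwfPowerAt (η i) (M i) x)
      (fun j _ => mwfPowerAt_antitone (hη j) (by linarith [hM j]) hx hxy.le)
      ⟨i, Finset.mem_univ i, mwfPowerAt_lt_of_pos (hη i) (by linarith [hM i]) hx hxy hi⟩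
    linarith
  have hm : IsMWFMultiplier P η M lam := ⟨lt_of_lt_of_le ha hlam.1, hsum⟩
  exact ⟨lam, hm, fun y hy => le_antisymm (not_lt.1 (key _ _ hm hy)) (not_lt.1 (key _ _ hy hm))⟩

lemma isMWFMultiplier_mwfMultiplier {n : ℕ} {P : ℝ} {η : Fin n → ℝ} {M : Fin n → ℕ}
    (h : ∃! lam, IsMWFMultiplier P η M lam) : IsMWFMultiplier P η M (mwfMultiplier P η M) := by
  rw [mwfMultiplier, dif_pos h]
  exact h.choose_spec.1

/-! ### Counting the switched-off subchannels -/

/-- If a fraction `δ` of the squared singular values lies in `[a, b]`, then the multiplier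
cannot be small, for otherwise those subchannels alone would use more than the total power.
Hence all subchannels with squared singular value at most a constant `θ`, which depends only on
`δ`, `a`, `b` and the signal-to-noise ratio, are switched off. -/
theorem exists_threshold_le_kOpt {δ a b SNR : ℝ} (hδ : 0 < δ) (ha : 0 < a) (hb : 0 < b)
    (hSNR : 0 < SNR) :
    ∃ θ : ℝ, 0 < θ ∧ ∀ (n : ℕ) (P s : ℝ) (A : Matrix (Fin n) (Fin n) ℂ) (M : Fin n → ℕ),
      0 < n → 0 < s → P / s = SNR → (∀ i, 4 ≤ M i) →
      (∃! lam, IsMWFMultiplier P (normalizedNoise s A) M lam) →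
      δ * n ≤ Nat.card {i // a ≤ singularValue A i ^ 2 ∧ singularValue A i ^ 2 ≤ b} →
      Nat.card {i // singularValue A i ^ 2 ≤ θ} ≤
        kOpt (mwfPower P (normalizedNoise s A) M) := by
  classical
  -- the value of `s * lam / n` at which the lower bound for the power used in `[a, b]` equals `P`,
  -- up to the harmless loss of the summand `9` under the root
  refine ⟨12 * a / (5 + 2 * b * SNR / δ) ^ 2, by positivity, ?_⟩
  intro n P s A M hn hs hP hM hex hcard
  obtain ⟨hlam, hsum⟩ := isMWFMultiplier_mwfMultiplier hex
  unfold mwfPower kOpt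
  set lam := mwfMultiplier P (normalizedNoise s A) M
  have hn' : (0 : ℝ) < n := by exact_mod_cast hn
  have hη : ∀ i, 0 ≤ normalizedNoise s A i := fun i => by
    unfold normalizedNoise
    positivity
  have hP' : P = SNR * s := by rw [← hP]; field_simp
  have hc : 0 < 5 + 2 * b * SNR / δ := by positivity
  have hθ : 12 * a / (5 + 2 * b * SNR / δ) ^ 2 ≤ s * lam / n := by
    by_contra! hlt
    have hlt' : (5 + 2 * b * SNR / δ) ^ 2 < 12 * a / (s * lam / n) := by
      rw [lt_div_iff₀ (by positivity)] at hlt ⊢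
      linarith
    have hsq : 5 + 2 * b * SNR / δ < √(9 + 12 * a / (s * lam / n)) :=
      Real.lt_sqrt_of_sq_lt (by linarith)
    have hterm : ∀ i, a ≤ singularValue A i ^ 2 → singularValue A i ^ 2 ≤ b →
        s / (2 * n * b) * (√(9 + 12 * a / (s * lam / n)) - 5) ≤
          mwfPowerAt (normalizedNoise s A i) (M i) lam := by
      intro i h1 h2
      refine le_trans ?_ (le_mwfPowerAt (hη i) hlam (hM i))
      have hx : 0 < singularValue A i ^ 2 := ha.trans_le h1
      have e1 : 12 / (normalizedNoise s A i * lam) =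
          12 * singularValue A i ^ 2 / (s * lam / n) := by
        unfold normalizedNoise
        field_simp
      have e2 : s / (2 * n * b) ≤ normalizedNoise s A i / 2 := by
        unfold normalizedNoise
        rw [div_div]
        refine div_le_div_of_nonneg_left hs.le (by positivity) ?_
        nlinarith
      rw [e1]
      have e3 : √(9 + 12 * a / (s * lam / n)) ≤
          √(9 + 12 * singularValue A i ^ 2 / (s * lam / n)) := by
        gcongr
      have : 0 ≤ 2 * b * SNR / δ := by positivity
      refine mul_le_mul e2 (by linarith) (by linarith) (by linarith [hη i])
    rw [Nat.card_eq_fintype_card, Fintype.card_subtype] at hcard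
    set B := Finset.univ.filter fun i => a ≤ singularValue A i ^ 2 ∧ singularValue A i ^ 2 ≤ b
    have h1 : (B.card : ℝ) * (s / (2 * n * b) * (√(9 + 12 * a / (s * lam / n)) - 5)) ≤ P := by
      rw [← hsum, ← nsmul_eq_mul]
      refine (Finset.card_nsmul_le_sum B _ _ fun i hi => ?_).trans
        (Finset.sum_le_sum_of_subset_of_nonneg (Finset.subset_univ B)
          fun i _ _ => mwfPowerAt_nonneg (hη i) _ _)
      exact hterm i (Finset.mem_filter.1 hi).2.1 (Finset.mem_filter.1 hi).2.2
    have h2 : (δ * n) * (s / (2 * n * b) * (2 * b * SNR / δ)) <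
        (B.card : ℝ) * (s / (2 * n * b) * (√(9 + 12 * a / (s * lam / n)) - 5)) := by
      refine mul_lt_mul' hcard ?_ (by positivity) ((by positivity : 0 < δ * n).trans_le hcard)
      exact mul_lt_mul_of_pos_left (by linarith) (by positivity)
    have h3 : (δ * n) * (s / (2 * n * b) * (2 * b * SNR / δ)) = P := by
      rw [hP']
      field_simp
    linarith
  refine Nat.card_le_card_of_injective (fun i => ⟨i.1, ?_⟩) fun i j hij => by
    simpa [Subtype.ext_iff] using hij
  obtain ⟨i, hi⟩ := i
  rcases (sq_nonneg (singularValue A i)).eq_or_lt with h0 | h0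
  · -- a vanishing singular value gives `normalizedNoise = 0` by division by zero, hence no power
    have : normalizedNoise s A i = 0 := by simp [normalizedNoise, ← h0]
    simp only [this, mwfPowerAt_zero_noise]
  · refine mwfPowerAt_eq_zero_of_one_le (by linarith [hM i]) ?_
    unfold normalizedNoise
    have h1 := hi.trans hθ
    rw [le_div_iff₀ hn'] at h1
    rw [div_mul_eq_mul_div, le_div_iff₀ (by positivity)]
    linarith

/-- A second- and fourth-moment bound forces a positive fraction of the numbers `x i` to be of
order one (a Paley–Zygmund argument). -/
lemma card_mem_Icc_ge_of_moments {n : ℕ} {x : Fin n → ℝ} (hx : ∀ i, 0 ≤ x i)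
    (h1 : (n : ℝ) / 6 ≤ ∑ i, x i) (h2 : ∑ i, x i ^ 2 ≤ 32 * n) :
    (1 / 4608 : ℝ) * n ≤ Nat.card {i // 1 / 12 ≤ x i ∧ x i ≤ 768} := by
  classical
  rw [Nat.card_eq_fintype_card, Fintype.card_subtype, Finset.card_filter]
  push_cast
  -- the parabola with these coefficients lies below the indicator function of `[1/12, 768]`
  have key : ∀ i, (1 / 192 : ℝ) * x i - (1 / 192) ^ 2 / 4 * x i ^ 2 - 1 / 192 * (1 / 12) ≤
      if 1 / 12 ≤ x i ∧ x i ≤ 768 then 1 else 0 := by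
    intro i
    have := hx i
    split_ifs with h
    · nlinarith [sq_nonneg (x i / 384 - 1)]
    · rcases not_and_or.1 h with h | h
      · nlinarith [sq_nonneg (x i)]
      · nlinarith
  have hs := Finset.sum_le_sum fun i (_ : i ∈ Finset.univ) => key i
  simp only [Finset.sum_sub_distrib, ← Finset.mul_sum, Finset.sum_const, Finset.card_univ,
    Fintype.card_fin, nsmul_eq_mul] at hs
  refine le_trans ?_ hs
  linarith

/-! ### Singular values: power sums and a min-max bound -/

open scoped Matrix in
lemma adjoint_comp_toEuclideanLin {n : ℕ} (A : Matrix (Fin n) (Fin n) ℂ) :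
    LinearMap.adjoint (Matrix.toEuclideanLin A) ∘ₗ Matrix.toEuclideanLin A =
      Matrix.toEuclideanLin (Aᴴ * A) := by
  rw [← Matrix.toEuclideanLin_conjTranspose_eq_adjoint, Matrix.toEuclideanLin_eq_toLin_orthonormal,
    ← Matrix.toLin_mul]

/-- An orthonormal basis of right singular vectors. -/
lemma exists_orthonormalBasis_singular {n : ℕ} (A : Matrix (Fin n) (Fin n) ℂ) :
    ∃ b : OrthonormalBasis (Fin n) ℂ (EuclideanSpace ℂ (Fin n)), ∀ i,
      (LinearMap.adjoint (Matrix.toEuclideanLin A) ∘ₗ Matrix.toEuclideanLin A) (b i) =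
        ((singularValue A i ^ 2 : ℝ) : ℂ) • b i := by
  have hn : Module.finrank ℂ (EuclideanSpace ℂ (Fin n)) = n := by simp
  refine ⟨(Matrix.toEuclideanLin A).isSymmetric_adjoint_comp_self.eigenvectorBasis hn, fun i => ?_⟩
  rw [LinearMap.IsSymmetric.apply_eigenvectorBasis, singularValue,
    LinearMap.sq_singularValues_fin _ hn]
  rfl

lemma trace_toEuclideanLin {n : ℕ} (A : Matrix (Fin n) (Fin n) ℂ) :
    LinearMap.trace ℂ _ (Matrix.toEuclideanLin A) = A.trace := by
  rw [Matrix.toEuclideanLin_eq_toLin_orthonormal, Matrix.trace_toLin_eq]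

lemma sum_sq_singularValue {n : ℕ} (A : Matrix (Fin n) (Fin n) ℂ) :
    ∑ i, singularValue A i ^ 2 = ∑ j, ∑ l, ‖A j l‖ ^ 2 := by
  obtain ⟨b, hb⟩ := exists_orthonormalBasis_singular A
  have h := LinearMap.trace_eq_sum_inner
    (LinearMap.adjoint (Matrix.toEuclideanLin A) ∘ₗ Matrix.toEuclideanLin A) b
  rw [adjoint_comp_toEuclideanLin, trace_toEuclideanLin] at h
  rw [← adjoint_comp_toEuclideanLin] at h
  simp_rw [hb, inner_smul_right, inner_self_eq_norm_sq_to_K, b.norm_eq_one] at h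
  apply Complex.ofReal_injective
  push_cast at h ⊢
  simp only [one_pow, mul_one] at h
  rw [← h, Matrix.trace, Finset.sum_comm]
  refine Finset.sum_congr rfl fun l _ => ?_
  rw [Matrix.diag_apply, Matrix.mul_apply]
  refine Finset.sum_congr rfl fun j _ => ?_
  rw [Matrix.conjTranspose_apply, ← Complex.conj_mul']
  rfl

/-- The trace of `(A * Aᴴ) ^ 2`, computed from the singular values and from the inner products of
the rows. -/
lemma sum_pow_four_singularValue {n : ℕ} (A : Matrix (Fin n) (Fin n) ℂ) :
    ∑ i, (singularValue A i ^ 2) ^ 2 = ∑ k, ∑ j, ‖∑ l, A j l * star (A k l)‖ ^ 2 := by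
  obtain ⟨b, hb⟩ := exists_orthonormalBasis_singular A
  set S := LinearMap.adjoint (Matrix.toEuclideanLin A) ∘ₗ Matrix.toEuclideanLin A with hS
  have h := LinearMap.trace_eq_sum_inner (S ∘ₗ S) b
  have hSS : S ∘ₗ S = Matrix.toEuclideanLin (A.conjTranspose * A * (A.conjTranspose * A)) := by
    rw [hS, adjoint_comp_toEuclideanLin, Matrix.toEuclideanLin_eq_toLin_orthonormal,
      ← Matrix.toLin_mul]
  rw [hSS, trace_toEuclideanLin, ← hSS] at h
  simp_rw [LinearMap.comp_apply, hb, map_smul, hb, inner_smul_right, inner_self_eq_norm_sq_to_K,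
    b.norm_eq_one] at h
  apply Complex.ofReal_injective
  push_cast at h ⊢
  simp only [one_pow, mul_one, ← pow_two] at h
  rw [← h, pow_two, Matrix.mul_assoc, Matrix.trace_mul_comm, ← Matrix.mul_assoc, Matrix.mul_assoc,
    Matrix.trace]
  refine Finset.sum_congr rfl fun k _ => ?_
  rw [Matrix.diag_apply, Matrix.mul_apply]
  refine Finset.sum_congr rfl fun j _ => ?_
  rw [← Complex.conj_mul']
  simp only [Matrix.mul_apply, Matrix.conjTranspose_apply, map_sum, map_mul, RCLike.star_def,
    Complex.conj_conj]
  congr 1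
  exact Finset.sum_congr rfl fun l _ => mul_comm _ _

lemma norm_sq_toEuclideanLin {n : ℕ} {A : Matrix (Fin n) (Fin n) ℂ}
    {b : OrthonormalBasis (Fin n) ℂ (EuclideanSpace ℂ (Fin n))}
    (hb : ∀ i, (LinearMap.adjoint (Matrix.toEuclideanLin A) ∘ₗ Matrix.toEuclideanLin A) (b i) =
        ((singularValue A i ^ 2 : ℝ) : ℂ) • b i) (w : EuclideanSpace ℂ (Fin n)) :
    ‖Matrix.toEuclideanLin A w‖ ^ 2 = ∑ i, singularValue A i ^ 2 * ‖inner ℂ (b i) w‖ ^ 2 := by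
  set T := Matrix.toEuclideanLin A
  have h1 : inner ℂ w ((LinearMap.adjoint T ∘ₗ T) w) = ((‖T w‖ ^ 2 : ℝ) : ℂ) := by
    rw [LinearMap.comp_apply, LinearMap.adjoint_inner_right, inner_self_eq_norm_sq_to_K]
    norm_cast
  apply Complex.ofReal_injective
  rw [← h1, ← b.sum_inner_mul_inner, Complex.ofReal_sum]
  refine Finset.sum_congr rfl fun i _ => ?_
  rw [← T.isSymmetric_adjoint_comp_self (b i) w, hb, inner_smul_left, Complex.conj_ofReal]
  push_cast
  rw [← Complex.conj_mul', inner_conj_symm]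
  ring

/-- A form of the min-max principle: if the matrix is small on `K` orthonormal vectors, then
it has at least `K` small singular values. -/
theorem le_card_singularValue_sq_le {n K : ℕ} {A : Matrix (Fin n) (Fin n) ℂ} {c : ℝ}
    {v : Fin K → EuclideanSpace ℂ (Fin n)} (hv : Orthonormal ℂ v)
    (hA : ∑ k, ‖Matrix.toEuclideanLin A (v k)‖ ^ 2 ≤ c) :
    K ≤ Nat.card {i // singularValue A i ^ 2 ≤ c} := by
  classical
  obtain ⟨b, hb⟩ := exists_orthonormalBasis_singular A
  by_contra! hlt
  -- a nonzero combination `w` of the `v k` orthogonal to all singular vectors with small value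
  let L : (Fin K → ℂ) →ₗ[ℂ] ({i // singularValue A i ^ 2 ≤ c} → ℂ) :=
    LinearMap.pi fun i => ((innerSL ℂ (b i.1)).toLinearMap).comp (Fintype.linearCombination ℂ v)
  have hker : LinearMap.ker L ≠ ⊥ := LinearMap.ker_ne_bot_of_finrank_lt (by
    rw [Module.finrank_fintype_fun_eq_card, Module.finrank_fintype_fun_eq_card, Fintype.card_fin,
      ← Nat.card_eq_fintype_card]
    exact hlt)
  obtain ⟨a, haL, ha0⟩ := (Submodule.ne_bot_iff _).1 hker
  set w := ∑ k, a k • v k with hw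
  have horth : ∀ i, singularValue A i ^ 2 ≤ c → inner ℂ (b i) w = 0 := fun i hi => by
    have := congrFun (LinearMap.mem_ker.1 haL) ⟨i, hi⟩
    simpa [L, Fintype.linearCombination_apply] using this
  have hnorm : ‖w‖ ^ 2 = ∑ k, ‖a k‖ ^ 2 := by
    have h1 : inner ℂ w w = ((∑ k, ‖a k‖ ^ 2 : ℝ) : ℂ) := by
      rw [hw, hv.inner_sum]
      push_cast
      exact Finset.sum_congr rfl fun k _ => Complex.conj_mul' _
    apply Complex.ofReal_injective
    rw [← h1, inner_self_eq_norm_sq_to_K]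
    norm_cast
  have hw0 : w ≠ 0 := fun h0 => by
    have hs : ∑ k, ‖a k‖ ^ 2 = 0 := by rw [← hnorm, h0]; simp
    refine ha0 (funext fun k => ?_)
    have := (Finset.sum_eq_zero_iff_of_nonneg fun k _ => sq_nonneg ‖a k‖).1 hs k (Finset.mem_univ k)
    simpa using this
  have hupper : ‖Matrix.toEuclideanLin A w‖ ^ 2 ≤ c * ‖w‖ ^ 2 := by
    have h1 : ‖Matrix.toEuclideanLin A w‖ ≤ ∑ k, ‖a k‖ * ‖Matrix.toEuclideanLin A (v k)‖ := by
      rw [hw, map_sum]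
      refine (norm_sum_le _ _).trans (Finset.sum_le_sum fun k _ => ?_)
      rw [map_smul, norm_smul]
    calc _ ≤ (∑ k, ‖a k‖ * ‖Matrix.toEuclideanLin A (v k)‖) ^ 2 := by gcongr
      _ ≤ (∑ k, ‖a k‖ ^ 2) * ∑ k, ‖Matrix.toEuclideanLin A (v k)‖ ^ 2 :=
        Finset.sum_mul_sq_le_sq_mul_sq _ _ _
      _ ≤ _ := by
        rw [hnorm, mul_comm]
        gcongr
  rw [norm_sq_toEuclideanLin hb, ← b.sum_sq_norm_inner_right w, Finset.mul_sum, ← sub_nonpos,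
    ← Finset.sum_sub_distrib] at hupper
  simp_rw [← sub_mul] at hupper
  have hnn : ∀ i ∈ Finset.univ, 0 ≤ (singularValue A i ^ 2 - c) * ‖inner ℂ (b i) w‖ ^ 2 := by
    intro i _
    rcases le_or_gt (singularValue A i ^ 2) c with h | h
    · simp [horth i h]
    · have := sub_pos.2 h
      positivity
  have hz := (Finset.sum_eq_zero_iff_of_nonneg hnn).1 (hupper.antisymm (Finset.sum_nonneg hnn))
  refine hw0 (norm_eq_zero.1 (pow_eq_zero_iff two_ne_zero |>.1 ?_))
  rw [← b.sum_sq_norm_inner_right w]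
  refine Finset.sum_eq_zero fun i hi => ?_
  rcases le_or_gt (singularValue A i ^ 2) c with h | h
  · simp [horth i h]
  · exact (mul_eq_zero.1 (hz i hi)).resolve_left (sub_pos.2 h).ne'

/-! ### Gaussian sums and chi-square tails -/

/-- The exponent is written as `1 / (2 * v) - b`, so that the density turns the integrand into a
multiple of `exp (-b * x ^ 2)`. -/
lemma integrable_exp_sq_gaussianReal_and_integral {v : ℝ≥0} (hv : v ≠ 0) {b : ℝ} (hb : 0 < b) :
    Integrable (fun x : ℝ => Real.exp ((1 / (2 * v) - b) * x ^ 2)) (gaussianReal 0 v) ∧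
      ∫ x, Real.exp ((1 / (2 * v) - b) * x ^ 2) ∂(gaussianReal 0 v) = √(1 / (2 * v * b)) := by
  have hv' : (0 : ℝ) < v := by positivity
  have e : (fun x : ℝ => gaussianPDFReal 0 v x • Real.exp ((1 / (2 * v) - b) * x ^ 2)) =
      fun x => (√(2 * Real.pi * v))⁻¹ * Real.exp (-b * x ^ 2) := by
    funext x
    rw [gaussianPDFReal, smul_eq_mul, mul_assoc, ← Real.exp_add]
    congr 2
    field_simp
    ring
  constructor
  · rw [gaussianReal_of_var_ne_zero _ hv, integrable_withDensity_iff_integrable_smul']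
    · simp only [toReal_gaussianPDF]
      rw [e]
      exact (integrable_exp_neg_mul_sq hb).const_mul _
    · exact measurable_gaussianPDF 0 v
    · exact ae_of_all _ fun x => by simp [gaussianPDF]
  · rw [integral_gaussianReal_eq_integral_smul hv, e, integral_const_mul, integral_gaussian,
      ← Real.sqrt_inv, ← Real.sqrt_mul (by positivity)]
    congr 1
    have := Real.pi_pos
    field_simp

section Independent

variable {Ω ι : Type*} [MeasurableSpace Ω] {μ : Measure Ω} [IsProbabilityMeasure μ] {X : ι → Ω → ℝ}

/-- The moment generating function of a chi-square sum, at `1 / (2 * v) - b`. -/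
lemma mgf_sum_sq_of_gaussian {v : ℝ≥0} (hv : v ≠ 0) (hmX : ∀ i, Measurable (X i))
    (hX : ∀ i, HasLaw (X i) (gaussianReal 0 v) μ) (hind : iIndepFun X μ) (s : Finset ι)
    {b : ℝ} (hb : 0 < b) :
    Integrable (fun ω => Real.exp ((1 / (2 * v) - b) * (∑ i ∈ s, fun ω => X i ω ^ 2) ω)) μ ∧
      mgf (∑ i ∈ s, fun ω => X i ω ^ 2) μ (1 / (2 * v) - b) = √(1 / (2 * v * b)) ^ s.card := by
  have hm : ∀ i, Measurable (fun ω => X i ω ^ 2) := fun i => (hmX i).pow_const 2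
  have hind' : iIndepFun (fun i ω => X i ω ^ 2) μ :=
    hind.comp (fun _ x => x ^ 2) fun _ => measurable_id.pow_const 2
  obtain ⟨h1, h2⟩ := integrable_exp_sq_gaussianReal_and_integral hv hb
  have hme : AEStronglyMeasurable (fun x : ℝ => Real.exp ((1 / (2 * v) - b) * x ^ 2))
      (gaussianReal 0 v) := h1.aestronglyMeasurable
  refine ⟨?_, ?_⟩
  · refine hind'.integrable_exp_mul_sum hm fun i _ => ?_
    have := (hX i).map_eq ▸ h1
    exact this.comp_aemeasurable (hX i).aemeasurable
  · rw [hind'.mgf_sum hm, Finset.prod_congr rfl fun i _ => ?_, Finset.prod_const]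
    rw [← h2, ← (hX i).integral_comp hme]
    rfl

/-- Upper chi-square tail: the Chernoff bound with exponent `1 / (4 * v)`. -/
lemma measureReal_le_sum_sq_gaussian {v : ℝ≥0} (hv : v ≠ 0)
    (hmX : ∀ i, Measurable (X i)) (hX : ∀ i, HasLaw (X i) (gaussianReal 0 v) μ)
    (hind : iIndepFun X μ) (s : Finset ι) (t : ℝ) :
    μ.real {ω | t ≤ ∑ i ∈ s, X i ω ^ 2} ≤ √2 ^ s.card * Real.exp (-(t / (4 * v))) := by
  have hv' : (0 : ℝ) < v := by positivity
  have hb : (0 : ℝ) < 1 / (4 * v) := by positivity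
  obtain ⟨h1, h2⟩ := mgf_sum_sq_of_gaussian hv hmX hX hind s hb
  have h3 := measure_ge_le_exp_mul_mgf (μ := μ) (X := ∑ i ∈ s, fun ω => X i ω ^ 2) t
    (t := 1 / (2 * v) - 1 / (4 * v)) (by field_simp; norm_num) h1
  rw [h2] at h3
  have e1 : (1 : ℝ) / (2 * v * (1 / (4 * v))) = 2 := by field_simp; norm_num
  have e2 : -((1 : ℝ) / (2 * v) - 1 / (4 * v)) * t = -(t / (4 * v)) := by field_simp; ring
  rw [e1, e2, mul_comm] at h3
  simpa using h3

/-- Lower chi-square tail: the Chernoff bound with exponent `-3 / (2 * v)`. -/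
lemma measureReal_sum_sq_gaussian_le {v : ℝ≥0} (hv : v ≠ 0)
    (hmX : ∀ i, Measurable (X i)) (hX : ∀ i, HasLaw (X i) (gaussianReal 0 v) μ)
    (hind : iIndepFun X μ) (s : Finset ι) (t : ℝ) :
    μ.real {ω | ∑ i ∈ s, X i ω ^ 2 ≤ t} ≤ (1 / 2) ^ s.card * Real.exp (3 * t / (2 * v)) := by
  have hv' : (0 : ℝ) < v := by positivity
  have hb : (0 : ℝ) < 2 / v := by positivity
  obtain ⟨h1, h2⟩ := mgf_sum_sq_of_gaussian hv hmX hX hind s hb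
  have h3 := measure_le_le_exp_mul_mgf (μ := μ) (X := ∑ i ∈ s, fun ω => X i ω ^ 2) t
    (t := 1 / (2 * v) - 2 / v) (by field_simp; norm_num) h1
  rw [h2] at h3
  have e1 : √((1 : ℝ) / (2 * v * (2 / v))) = 1 / 2 := by
    rw [show (1 : ℝ) / (2 * v * (2 / v)) = (1 / 2) ^ 2 by field_simp,
      Real.sqrt_sq (by norm_num)]
  have e2 : -((1 : ℝ) / (2 * v) - 2 / v) * t = 3 * t / (2 * v) := by field_simp; ring
  rw [e1, e2, mul_comm] at h3
  simpa using h3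

lemma hasLaw_sum_gaussianReal [Fintype ι] {v : ι → ℝ≥0}
    (hX : ∀ i, HasLaw (X i) (gaussianReal 0 (v i)) μ) (hind : iIndepFun X μ) :
    HasLaw (fun ω => ∑ i, X i ω) (gaussianReal 0 (∑ i, v i)) μ where
  aemeasurable := Finset.aemeasurable_fun_sum _ fun i _ => (hX i).aemeasurable
  map_eq := by
    have : IsProbabilityMeasure (μ.map (fun ω => ∑ i, X i ω)) :=
      Measure.isProbabilityMeasure_map
        (Finset.aemeasurable_fun_sum _ fun i _ => (hX i).aemeasurable)
    refine Measure.ext_of_charFun ?_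
    rw [hind.charFun_map_fun_sum_eq_prod fun i => (hX i).aemeasurable]
    funext t
    rw [Finset.prod_apply]
    simp_rw [(hX _).map_eq, charFun_gaussianReal]
    rw [← Complex.exp_sum]
    congr 1
    push_cast
    simp [Finset.sum_div, Finset.sum_mul]

end Independent

/-! ### Complex Gaussian vectors and matrices -/

lemma measurable_complex_mk : Measurable fun p : ℝ × ℝ => (⟨p.1, p.2⟩ : ℂ) :=
  Complex.measurableEquivRealProd.symm.measurable

instance (v : ℝ≥0) : IsProbabilityMeasure (complexGaussian v) :=
  Measure.isProbabilityMeasure_map measurable_complex_mk.aemeasurable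

lemma hasLaw_re_mul_complexGaussian (v : ℝ≥0) (w : ℂ) :
    HasLaw (fun z : ℂ => (z * w).re) (gaussianReal 0 (‖w‖₊ ^ 2 * (v / 2)))
      (complexGaussian v) where
  aemeasurable := by fun_prop
  map_eq := by
    rw [complexGaussian, Measure.map_map (by fun_prop) measurable_complex_mk]
    set γ := gaussianReal 0 (v / 2)
    have hX : HasLaw (fun p : ℝ × ℝ => w.re * p.1) _ (γ.prod γ) :=
      gaussianReal_const_mul (measurePreserving_fst (μ := γ) (ν := γ)).hasLaw w.re
    have hY : HasLaw (fun p : ℝ × ℝ => -w.im * p.2) _ (γ.prod γ) :=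
      gaussianReal_const_mul (measurePreserving_snd (μ := γ) (ν := γ)).hasLaw (-w.im)
    have hXY : IndepFun (fun p : ℝ × ℝ => w.re * p.1) (fun p : ℝ × ℝ => -w.im * p.2)
        (γ.prod γ) :=
      indepFun_prod (X := fun x => w.re * x) (Y := fun y => -w.im * y) (by fun_prop) (by fun_prop)
    have := gaussianReal_add_gaussianReal_of_indepFun hXY hX.map_eq hY.map_eq
    convert this using 2
    · funext p
      simp [Complex.mul_re]
      ring
    · simp
    · ext
      push_cast
      rw [← Complex.normSq_eq_norm_sq, Complex.normSq_apply]
      simp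
      ring

/-- The law of a vector of `n` independent `𝒞𝒩(0, 1/n)` entries. -/
noncomputable def gaussianRow (n : ℕ) : Measure (Fin n → ℂ) :=
  Measure.pi fun _ => complexGaussian (1 / (n : ℝ≥0))

/-- The law of an `n × n` complex Gaussian matrix, regarded as a product of its row laws. -/
noncomputable def gaussianMatrix (n : ℕ) : Measure (Fin n → Fin n → ℂ) :=
  Measure.pi fun _ => gaussianRow n

instance (n : ℕ) : IsProbabilityMeasure (gaussianRow n) := by
  unfold gaussianRow; infer_instance

instance (n : ℕ) : IsProbabilityMeasure (gaussianMatrix n) := by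
  unfold gaussianMatrix; infer_instance

/-- The real part of the projection of a Gaussian row on a fixed unit vector is Gaussian. -/
lemma hasLaw_re_dot_gaussianRow {n : ℕ} {w : Fin n → ℂ} (hw : ∑ l, ‖w l‖ ^ 2 = 1) :
    HasLaw (fun h : Fin n → ℂ => (∑ l, h l * w l).re) (gaussianReal 0 (1 / (n : ℝ≥0) / 2))
      (gaussianRow n) := by
  have hlaw : ∀ l, HasLaw (fun h : Fin n → ℂ => (h l * w l).re)
      (gaussianReal 0 (‖w l‖₊ ^ 2 * (1 / (n : ℝ≥0) / 2))) (gaussianRow n) := fun l =>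
    (hasLaw_re_mul_complexGaussian _ (w l)).fun_comp
      (measurePreserving_eval (fun _ => complexGaussian (1 / (n : ℝ≥0))) l).hasLaw
  have hind : iIndepFun (fun l (h : Fin n → ℂ) => (h l * w l).re) (gaussianRow n) :=
    iIndepFun_pi (X := fun l z => (z * w l).re) fun l => by fun_prop
  have := hasLaw_sum_gaussianReal hlaw hind
  rw [← Finset.sum_mul] at this
  have hw' : ∑ l, ‖w l‖₊ ^ 2 = 1 := by
    ext
    push_cast
    exact hw
  rw [hw', one_mul] at this
  simpa [Complex.re_sum] using this

lemma gaussian_variance_ne_zero {n : ℕ} (hn : n ≠ 0) : 1 / (n : ℝ≥0) / 2 ≠ 0 := by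
  have : (n : ℝ≥0) ≠ 0 := by exact_mod_cast hn
  positivity

/-- Projections of the rows in `S` on a fixed unit vector: a chi-square upper tail. -/
lemma gaussianMatrix_le_sum_norm_sq_dot {n : ℕ} (hn : n ≠ 0) {w : Fin n → ℂ}
    (hw : ∑ l, ‖w l‖ ^ 2 = 1) (S : Finset (Fin n)) (t : ℝ) :
    (gaussianMatrix n).real {A | t ≤ ∑ j ∈ S, ‖∑ l, A j l * w l‖ ^ 2} ≤
      2 * (√2 ^ S.card * Real.exp (-(n * t / 4))) := by
  -- bound for the squared real parts; the imaginary parts are those of the unit vector `-I • w`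
  have key : ∀ u : Fin n → ℂ, ∑ l, ‖u l‖ ^ 2 = 1 →
      (gaussianMatrix n).real {A | t / 2 ≤ ∑ j ∈ S, (∑ l, A j l * u l).re ^ 2} ≤
        √2 ^ S.card * Real.exp (-(n * t / 4)) := by
    intro u hu
    have hmeas : Measurable fun h : Fin n → ℂ => (∑ l, h l * u l).re := by fun_prop
    have hlaw : ∀ j, HasLaw (fun A : Fin n → Fin n → ℂ => (∑ l, A j l * u l).re)
        (gaussianReal 0 (1 / (n : ℝ≥0) / 2)) (gaussianMatrix n) := fun j =>
      (hasLaw_re_dot_gaussianRow hu).fun_comp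
        (measurePreserving_eval (fun _ : Fin n => gaussianRow n) j).hasLaw
    have hind : iIndepFun (fun j (A : Fin n → Fin n → ℂ) => (∑ l, A j l * u l).re)
        (gaussianMatrix n) :=
      iIndepFun_pi (X := fun _ (h : Fin n → ℂ) => (∑ l, h l * u l).re)
        fun _ => hmeas.aemeasurable
    have := measureReal_le_sum_sq_gaussian (gaussian_variance_ne_zero hn)
      (fun j => hmeas.comp (measurable_pi_apply j)) hlaw hind S (t / 2)
    refine this.trans_eq ?_
    have hn' : (n : ℝ) ≠ 0 := by exact_mod_cast hn
    congr 3
    push_cast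
    field_simp
  have hw2 : ∑ l, ‖-Complex.I * w l‖ ^ 2 = 1 := by simpa using hw
  have hsub : {A : Fin n → Fin n → ℂ | t ≤ ∑ j ∈ S, ‖∑ l, A j l * w l‖ ^ 2} ⊆
      {A | t / 2 ≤ ∑ j ∈ S, (∑ l, A j l * w l).re ^ 2} ∪
        {A | t / 2 ≤ ∑ j ∈ S, (∑ l, A j l * (-Complex.I * w l)).re ^ 2} := by
    intro A hA
    by_contra hcon
    simp only [Set.mem_union, Set.mem_ofPred_eq, not_or, not_le] at hcon hA
    have him : ∀ j, (∑ l, A j l * (-Complex.I * w l)).re = (∑ l, A j l * w l).im := by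
      intro j
      have : ∑ l, A j l * (-Complex.I * w l) = -Complex.I * ∑ l, A j l * w l := by
        rw [Finset.mul_sum]
        exact Finset.sum_congr rfl fun l _ => by ring
      rw [this]
      simp
    simp_rw [him] at hcon
    have : ∑ j ∈ S, ‖∑ l, A j l * w l‖ ^ 2 =
        ∑ j ∈ S, (∑ l, A j l * w l).re ^ 2 + ∑ j ∈ S, (∑ l, A j l * w l).im ^ 2 := by
      rw [← Finset.sum_add_distrib]
      refine Finset.sum_congr rfl fun j _ => ?_
      rw [← Complex.normSq_eq_norm_sq, Complex.normSq_apply]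
      ring
    linarith
  calc _ ≤ _ := measureReal_mono hsub
    _ ≤ _ := measureReal_union_le _ _
    _ ≤ _ := by linarith [key w hw, key _ hw2]

/-- Real and imaginary parts of the entries of a Gaussian row, as `re (h l * u)` with `u = 1`
and `u = -I`. -/
lemma hasLaw_re_mul_gaussianRow {n : ℕ} {u : ℂ} (hu : ‖u‖ = 1) (l : Fin n) :
    HasLaw (fun h : Fin n → ℂ => (h l * u).re) (gaussianReal 0 (1 / (n : ℝ≥0) / 2))
      (gaussianRow n) := by
  have hu' : ‖u‖₊ = 1 := by
    ext
    exact hu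
  have := (hasLaw_re_mul_complexGaussian (1 / (n : ℝ≥0)) u).fun_comp
    (measurePreserving_eval (fun _ : Fin n => complexGaussian (1 / (n : ℝ≥0))) l).hasLaw
  rwa [hu', one_pow, one_mul] at this

lemma iIndepFun_re_mul_gaussianRow {n : ℕ} (u : ℂ) :
    iIndepFun (fun l (h : Fin n → ℂ) => (h l * u).re) (gaussianRow n) :=
  iIndepFun_pi (X := fun _ z => (z * u).re) fun l => by fun_prop

lemma gaussianRow_le_sum_norm_sq {n : ℕ} (hn : n ≠ 0) :
    (gaussianRow n).real {h | 4 ≤ ∑ l, ‖h l‖ ^ 2} ≤ 2 * (√2 ^ n * Real.exp (-n)) := by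
  have key : ∀ u : ℂ, ‖u‖ = 1 → (gaussianRow n).real {h | 2 ≤ ∑ l, (h l * u).re ^ 2} ≤
      √2 ^ n * Real.exp (-n) := by
    intro u hu
    have := measureReal_le_sum_sq_gaussian (gaussian_variance_ne_zero hn)
      (fun l => by fun_prop) (hasLaw_re_mul_gaussianRow hu)
      (iIndepFun_re_mul_gaussianRow (n := n) u) Finset.univ 2
    refine this.trans_eq ?_
    have hn' : (n : ℝ) ≠ 0 := by exact_mod_cast hn
    rw [Finset.card_univ, Fintype.card_fin]
    congr 3
    push_cast
    field_simp
    norm_num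
  have hsub : {h : Fin n → ℂ | 4 ≤ ∑ l, ‖h l‖ ^ 2} ⊆
      {h | 2 ≤ ∑ l, (h l * 1).re ^ 2} ∪ {h | 2 ≤ ∑ l, (h l * -Complex.I).re ^ 2} := by
    intro h hh
    by_contra hcon
    simp only [Set.mem_union, Set.mem_ofPred_eq, not_or, not_le] at hcon hh
    have : ∑ l, ‖h l‖ ^ 2 = ∑ l, (h l * 1).re ^ 2 + ∑ l, (h l * -Complex.I).re ^ 2 := by
      rw [← Finset.sum_add_distrib]
      refine Finset.sum_congr rfl fun j _ => ?_
      rw [← Complex.normSq_eq_norm_sq, Complex.normSq_apply]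
      simp
      ring
    linarith
  calc _ ≤ _ := measureReal_mono hsub
    _ ≤ _ := measureReal_union_le _ _
    _ ≤ _ := by linarith [key 1 (by simp), key (-Complex.I) (by simp)]

lemma gaussianRow_sum_norm_sq_le {n : ℕ} (hn : n ≠ 0) :
    (gaussianRow n).real {h | ∑ l, ‖h l‖ ^ 2 ≤ 1 / 6} ≤ (1 / 2) ^ n * Real.exp (n / 2) := by
  have := measureReal_sum_sq_gaussian_le (gaussian_variance_ne_zero hn)
      (fun l => by fun_prop) (hasLaw_re_mul_gaussianRow (u := 1) (by simp))
      (iIndepFun_re_mul_gaussianRow (n := n) 1) Finset.univ (1 / 6)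
  refine (measureReal_mono fun h hh => ?_).trans (this.trans_eq ?_)
  · rw [Set.mem_ofPred_eq] at hh ⊢
    refine (Finset.sum_le_sum fun l _ => ?_).trans hh
    rw [mul_one]
    exact sq_le_sq' (by linarith [Complex.abs_re_le_norm (h l), neg_abs_le (h l).re])
      (Complex.re_le_norm _)
  · have hn' : (n : ℝ) ≠ 0 := by exact_mod_cast hn
    rw [Finset.card_univ, Fintype.card_fin]
    congr 2
    push_cast
    field_simp
    norm_num

/-! ### Conditioning on a set of rows -/

/-- If redrawing the coordinates in `S` puts any given point into `B` with probability at most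
`ε`, then `B` has probability at most `ε`. -/
lemma pi_le_of_forall_redraw {ι E : Type*} [Fintype ι] [MeasurableSpace E]
    {ρ : Measure E} [IsProbabilityMeasure ρ] (S : Finset ι) [∀ i, Decidable (i ∈ S)]
    {B : Set (ι → E)} (hB : MeasurableSet B) {ε : ℝ} (hε : 0 ≤ ε)
    (h : ∀ z, (Measure.pi fun _ : ι => ρ).real {x | S.piecewise x z ∈ B} ≤ ε) :
    (Measure.pi fun _ : ι => ρ).real B ≤ ε := by
  set π := Measure.pi fun _ : ι => ρ with hπ
  have hmeas : Measurable fun p : (ι → E) × (ι → E) => S.piecewise p.2 p.1 := by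
    refine measurable_pi_lambda _ fun i => ?_
    by_cases hi : i ∈ S
    · simp only [Finset.piecewise, hi, if_true]
      fun_prop
    · simp only [Finset.piecewise, hi, if_false]
      fun_prop
  have hmap : (π.prod π).map (fun p => S.piecewise p.2 p.1) = π := by
    refine (Measure.pi_eq fun s hs => ?_).symm
    rw [Measure.map_apply hmeas (.univ_pi hs)]
    have : (fun p : (ι → E) × (ι → E) => S.piecewise p.2 p.1) ⁻¹' Set.univ.pi s =
        (Set.univ.pi fun i => if i ∈ S then Set.univ else s i) ×ˢ
          (Set.univ.pi fun i => if i ∈ S then s i else Set.univ) := by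
      ext p
      simp only [Set.mem_preimage, Set.mem_pi, Set.mem_univ, true_implies, Set.mem_prod,
        ← forall_and]
      refine forall_congr' fun i => ?_
      by_cases hi : i ∈ S <;> simp [hi]
    rw [this, Measure.prod_prod, hπ, Measure.pi_pi, Measure.pi_pi, ← Finset.prod_mul_distrib]
    refine Finset.prod_congr rfl fun i _ => ?_
    by_cases hi : i ∈ S <;> simp [hi]
  have : π B ≤ ENNReal.ofReal ε := by
    rw [← hmap, Measure.map_apply hmeas hB, Measure.prod_apply (hmeas hB)]
    calc ∫⁻ z, π (Prod.mk z ⁻¹' ((fun p => S.piecewise p.2 p.1) ⁻¹' B)) ∂π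
        ≤ ∫⁻ _, ENNReal.ofReal ε ∂π := by
          refine lintegral_mono fun z => ?_
          have := h z
          rw [measureReal_def] at this
          exact (ENNReal.le_ofReal_iff_toReal_le (measure_ne_top _ _) hε).2 this
      _ = ENNReal.ofReal ε := by simp
  exact ENNReal.toReal_le_of_le_ofReal hε this

/-- Given row `k`, the other rows are independent of it, so that their squared inner products
with it sum to at most four times its squared norm, outside an event of exponentially small
probability. -/
lemma gaussianMatrix_cross_terms {n : ℕ} (hn : n ≠ 0) (k : Fin n) :
    (gaussianMatrix n).real {A | 4 * ∑ l, ‖A k l‖ ^ 2 <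
      ∑ j ∈ Finset.univ.erase k, ‖∑ l, A j l * star (A k l)‖ ^ 2} ≤
      2 * (√2 ^ n * Real.exp (-n)) := by
  refine pi_le_of_forall_redraw (ρ := gaussianRow n) (Finset.univ.erase k)
    (measurableSet_lt (by fun_prop) (by fun_prop)) (by positivity) fun z => ?_
  rcases eq_or_ne (∑ l, ‖z k l‖ ^ 2) 0 with h0 | h0
  · -- a vanishing row `k` has vanishing inner products
    have hz : ∀ l, z k l = 0 := fun l => by
      have := (Finset.sum_eq_zero_iff_of_nonneg fun l _ => sq_nonneg ‖z k l‖).1 h0 l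
        (Finset.mem_univ l)
      simpa using this
    refine le_of_eq_of_le ?_ (by positivity : (0 : ℝ) ≤ 2 * (√2 ^ n * Real.exp (-n)))
    convert measureReal_empty
    ext x
    simp [hz]
  have hpos : 0 < ∑ l, ‖z k l‖ ^ 2 :=
    lt_of_le_of_ne (Finset.sum_nonneg fun _ _ => sq_nonneg _) (Ne.symm h0)
  set r := √(∑ l, ‖z k l‖ ^ 2) with hr
  have hr0 : 0 < r := Real.sqrt_pos.2 hpos
  have hr2 : r ^ 2 = ∑ l, ‖z k l‖ ^ 2 := Real.sq_sqrt hpos.le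
  have hw : ∑ l, ‖star (z k l) / (r : ℂ)‖ ^ 2 = 1 := by
    simp_rw [norm_div, norm_star, Complex.norm_real, div_pow, Real.norm_eq_abs, sq_abs]
    rw [← Finset.sum_div, hr2, div_self h0]
  refine (measureReal_mono fun x hx => ?_).trans
    ((gaussianMatrix_le_sum_norm_sq_dot hn hw (Finset.univ.erase k) 4).trans ?_)
  · simp only [Set.mem_ofPred_eq] at hx ⊢
    have hk : (Finset.univ.erase k).piecewise x z k = z k := by simp [Finset.piecewise]
    rw [hk, ← hr2] at hx
    have : ∑ j ∈ Finset.univ.erase k,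
        ‖∑ l, (Finset.univ.erase k).piecewise x z j l * star (z k l)‖ ^ 2 =
        r ^ 2 * ∑ j ∈ Finset.univ.erase k, ‖∑ l, x j l * (star (z k l) / (r : ℂ))‖ ^ 2 := by
      rw [Finset.mul_sum]
      refine Finset.sum_congr rfl fun j hj => ?_
      rw [Finset.piecewise_eq_of_mem _ _ _ hj]
      simp_rw [← mul_div_assoc]
      rw [← Finset.sum_div, norm_div, Complex.norm_real, div_pow, Real.norm_eq_abs, sq_abs]
      field_simp
    rw [this] at hx
    have h2 : 0 < r ^ 2 := by positivity
    nlinarith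
  · have h1 : (Finset.univ.erase k).card ≤ n := by
      simp
    have h2 : (1 : ℝ) ≤ √2 := Real.one_le_sqrt.2 (by norm_num)
    have h3 : (n : ℝ) * 4 / 4 = n := by ring
    rw [h3]
    gcongr

/-! ### Many small singular values -/

/-- Matrices (as families of rows) that are small, in the Hilbert–Schmidt sense, on some
`K`-dimensional subspace. -/
def smallOnSubspace (n K : ℕ) (c : ℝ) : Set (Fin n → Fin n → ℂ) :=
  {A | ∃ v : Fin K → EuclideanSpace ℂ (Fin n), Orthonormal ℂ v ∧
    ∑ k, ∑ j, ‖∑ l, A j l * v k l‖ ^ 2 ≤ c}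

lemma isClosed_smallOnSubspace (n K : ℕ) (c : ℝ) : IsClosed (smallOnSubspace n K c) := by
  -- project a closed set along the compact set of frames in the unit ball
  let C := Set.pi Set.univ fun _ : Fin K => Metric.closedBall (0 : EuclideanSpace ℂ (Fin n)) 1
  have hC : IsCompact C := isCompact_univ_pi fun _ => isCompact_closedBall _ _
  have : CompactSpace C := isCompact_iff_compactSpace.1 hC
  let F : Set ((Fin n → Fin n → ℂ) × C) := {p | (∀ i j, inner ℂ (p.2.1 i) (p.2.1 j) =
      if i = j then (1 : ℂ) else 0) ∧ ∑ k, ∑ j, ‖∑ l, p.1 j l * p.2.1 k l‖ ^ 2 ≤ c}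
  have hcoord : ∀ k, Continuous fun p : (Fin n → Fin n → ℂ) × C => p.2.1 k := fun k =>
    (continuous_apply k).comp (continuous_subtype_val.comp continuous_snd)
  have hF : IsClosed F := by
    have h1 : IsClosed {p : (Fin n → Fin n → ℂ) × C | ∀ i j, inner ℂ (p.2.1 i) (p.2.1 j) =
        if i = j then (1 : ℂ) else 0} := by
      simp only [Set.ofPred_forall]
      exact isClosed_iInter fun i => isClosed_iInter fun j =>
        isClosed_eq ((hcoord i).inner (hcoord j)) continuous_const
    have h2 : IsClosed {p : (Fin n → Fin n → ℂ) × C |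
        ∑ k, ∑ j, ‖∑ l, p.1 j l * p.2.1 k l‖ ^ 2 ≤ c} := by
      refine isClosed_le (continuous_finsetSum _ fun k _ => continuous_finsetSum _ fun j _ =>
        (continuous_finsetSum _ fun l _ => ?_).norm.pow 2) continuous_const
      exact (by fun_prop : Continuous fun p : (Fin n → Fin n → ℂ) × C => p.1 j l).mul
        ((EuclideanSpace.proj l).continuous.comp (hcoord k))
    exact h1.inter h2
  have himg : smallOnSubspace n K c = Prod.fst '' F := by
    ext A
    simp only [smallOnSubspace, Set.mem_ofPred_eq, Set.mem_image, Prod.exists, exists_and_right,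
      exists_eq_right, F]
    constructor
    · rintro ⟨v, hv, hA⟩
      exact ⟨⟨v, fun k _ => by simp [hv.1 k]⟩, orthonormal_iff_ite.1 hv, hA⟩
    · rintro ⟨⟨v, hvC⟩, hv, hA⟩
      exact ⟨v, orthonormal_iff_ite.2 hv, hA⟩
  rw [himg]
  exact isClosedMap_fst_of_compactSpace _ hF

/-- `n - K` linear conditions on `ℂⁿ` leave room for `K` orthonormal solutions. -/
lemma exists_orthonormal_dot_eq_zero {n K : ℕ} (S : Finset (Fin n)) (hS : S.card = K)
    (z : Fin n → Fin n → ℂ) :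
    ∃ v : Fin K → EuclideanSpace ℂ (Fin n), Orthonormal ℂ v ∧
      ∀ k, ∀ j ∉ S, ∑ l, z j l * v k l = 0 := by
  classical
  let L : EuclideanSpace ℂ (Fin n) →ₗ[ℂ] ({j // j ∉ S} → ℂ) :=
    LinearMap.pi fun j => ∑ l, z j.1 l • (EuclideanSpace.proj l).toLinearMap
  have hdim : K ≤ Module.finrank ℂ (LinearMap.ker L) := by
    have h1 := L.finrank_range_add_finrank_ker
    have h2 := (LinearMap.range L).finrank_le
    have h3 : Fintype.card {j // j ∉ S} = n - K := by
      rw [Fintype.card_subtype_compl]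
      simp [hS]
    rw [Module.finrank_fintype_fun_eq_card, h3] at h2
    rw [finrank_euclideanSpace_fin] at h1
    have : K ≤ n := by
      rw [← hS]
      simpa using Finset.card_le_univ S
    omega
  refine ⟨fun k => (stdOrthonormalBasis ℂ (LinearMap.ker L) (Fin.castLE hdim k) :
    EuclideanSpace ℂ (Fin n)), ?_, ?_⟩
  · exact ((stdOrthonormalBasis ℂ (LinearMap.ker L)).orthonormal.comp _
      (Fin.castLE_injective hdim)).comp_linearIsometry (LinearMap.ker L).subtypeₗᵢ
  · intro k j hj
    have := congrFun (LinearMap.mem_ker.1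
      (stdOrthonormalBasis ℂ (LinearMap.ker L) (Fin.castLE hdim k)).2) ⟨j, hj⟩
    simpa [L, LinearMap.sum_apply] using this

/-- On the orthogonal complement of the first `n - K` rows, only the last `K` rows act, and each
of their `K ^ 2` coefficients there has variance `1 / n`. -/
lemma gaussianMatrix_compl_smallOnSubspace {n K : ℕ} (hn : n ≠ 0) (hK : K ≤ n) {c : ℝ}
    (hc : 0 ≤ c) :
    (gaussianMatrix n).real (smallOnSubspace n K c)ᶜ ≤
      K * (2 * (√2 ^ K * Real.exp (-(n * (c / K) / 4)))) := by
  classical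
  obtain ⟨S, -, hS⟩ := Finset.exists_subset_card_eq (s := (Finset.univ : Finset (Fin n)))
    (n := K) (by simpa using hK)
  refine pi_le_of_forall_redraw (ρ := gaussianRow n) S
    (isClosed_smallOnSubspace n K c).measurableSet.compl (by positivity) fun z => ?_
  obtain ⟨v, hv, hz⟩ := exists_orthonormal_dot_eq_zero S hS z
  have hsub : {x | S.piecewise x z ∈ (smallOnSubspace n K c)ᶜ} ⊆
      ⋃ k : Fin K, {x | c / K ≤ ∑ j ∈ S, ‖∑ l, x j l * v k l‖ ^ 2} := by
    intro x hx
    by_contra hcon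
    simp only [Set.mem_iUnion, Set.mem_ofPred_eq, not_exists, not_le] at hcon
    refine hx ⟨v, hv, ?_⟩
    have h1 : ∀ k, ∑ j, ‖∑ l, S.piecewise x z j l * v k l‖ ^ 2 =
        ∑ j ∈ S, ‖∑ l, x j l * v k l‖ ^ 2 := by
      intro k
      rw [← Finset.sum_subset (Finset.subset_univ S)]
      · exact Finset.sum_congr rfl fun j hj => by rw [Finset.piecewise_eq_of_mem _ _ _ hj]
      · intro j _ hj
        rw [Finset.piecewise_eq_of_notMem _ _ _ hj, hz k j hj]
        simp
    simp_rw [h1]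
    refine (Finset.sum_le_sum fun k _ => (hcon k).le).trans ?_
    rw [Finset.sum_const, Finset.card_univ, Fintype.card_fin, nsmul_eq_mul]
    rcases Nat.eq_zero_or_pos K with h | h
    · simpa [h] using hc
    · have : (0 : ℝ) < K := by exact_mod_cast h
      rw [mul_div_cancel₀ _ this.ne']
  refine (measureReal_mono hsub).trans ((measureReal_iUnion_fintype_le _).trans ?_)
  refine (Finset.sum_le_sum fun k _ => gaussianMatrix_le_sum_norm_sq_dot hn (w := v k) ?_ S
    (c / K)).trans_eq ?_
  · have := hv.1 k
    rw [EuclideanSpace.norm_eq, Real.sqrt_eq_one] at this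
    exact this
  · rw [hS, Finset.sum_const, Finset.card_univ, Fintype.card_fin, nsmul_eq_mul]

/-! ### Almost sure asymptotics -/

/-- The matrix as a whole has the product law; every event below is thus an event on this space. -/
lemma hasLaw_gaussianMatrix {Ω : Type*} [MeasurableSpace Ω] {μ : Measure Ω} {n : ℕ}
    {H : Ω → Matrix (Fin n) (Fin n) ℂ} (hH : IsComplexGaussianMatrix H μ) :
    HasLaw (fun ω i j => H ω i j) (gaussianMatrix n) μ := by
  have h1 : HasLaw (fun ω (q : Fin n × Fin n) => H ω q.1 q.2)
      (Measure.pi fun _ => complexGaussian (1 / (n : ℝ≥0))) μ :=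
    hH.indep.hasLaw_pi fun q => hH.hasLaw q.1 q.2
  have h2 : Measure.pi (fun _ : Fin n × Fin n => complexGaussian (1 / (n : ℝ≥0))) =
      (gaussianMatrix n).map fun A q => A q.1 q.2 := by
    refine Measure.pi_eq fun s hs => ?_
    rw [Measure.map_apply (by fun_prop) (.univ_pi hs)]
    have : (fun (A : Fin n → Fin n → ℂ) (q : Fin n × Fin n) => A q.1 q.2) ⁻¹' Set.univ.pi s =
        Set.univ.pi fun i => Set.univ.pi fun j => s (i, j) := by
      ext A
      simp
    rw [this, gaussianMatrix, Measure.pi_pi, Fintype.prod_prod_type]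
    simp_rw [gaussianRow, Measure.pi_pi]
  have h3 : HasLaw (fun (B : Fin n × Fin n → ℂ) i j => B (i, j)) (gaussianMatrix n)
      (Measure.pi fun _ => complexGaussian (1 / (n : ℝ≥0))) := by
    have hm : Measurable fun (B : Fin n × Fin n → ℂ) i j => B (i, j) :=
      measurable_pi_lambda _ fun i => measurable_pi_lambda _ fun j => measurable_pi_apply (i, j)
    refine ⟨hm.aemeasurable, ?_⟩
    rw [h2, Measure.map_map hm (by fun_prop)]
    exact Measure.map_id
  exact h3.fun_comp h1

/-- The first Borel–Cantelli lemma, for sets that need not be measurable. -/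
lemma ae_eventually_notMem_of_summable {Ω : Type*} [MeasurableSpace Ω] {μ : Measure Ω}
    [IsFiniteMeasure μ] {s : ℕ → Set Ω} {f : ℕ → ℝ} (hf : Summable f)
    (h : ∀ n, μ.real (s n) ≤ f n) : ∀ᵐ ω ∂μ, ∀ᶠ n in atTop, ω ∉ s n := by
  refine ae_eventually_notMem (ne_top_of_le_ne_top hf.tsum_ofReal_ne_top
    (ENNReal.tsum_le_tsum fun n => ?_))
  rw [← ofReal_measureReal]
  exact ENNReal.ofReal_le_ofReal (h n)

lemma measureReal_preimage_le_gaussianMatrix {Ω : Type*} [MeasurableSpace Ω] {μ : Measure Ω}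
    {n : ℕ} {H : Ω → Matrix (Fin n) (Fin n) ℂ} (hH : IsComplexGaussianMatrix H μ)
    (s : Set (Fin n → Fin n → ℂ)) : μ.real {ω | H ω ∈ s} ≤ (gaussianMatrix n).real s := by
  have hl := hasLaw_gaussianMatrix hH
  refine ENNReal.toReal_mono (measure_ne_top _ _) ?_
  rw [← hl.map_eq]
  exact Measure.le_map_apply hl.aemeasurable s

/-- Matrices whose rows have squared norm of order one and are, on average, nearly orthogonal. -/
def balancedRows (n : ℕ) : Set (Fin n → Fin n → ℂ) :=
  {A | ∀ k, 1 / 6 < ∑ l, ‖A k l‖ ^ 2 ∧ ∑ l, ‖A k l‖ ^ 2 < 4 ∧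
    ∑ j ∈ Finset.univ.erase k, ‖∑ l, A j l * star (A k l)‖ ^ 2 ≤ 4 * ∑ l, ‖A k l‖ ^ 2}

lemma gaussianMatrix_compl_balancedRows {n : ℕ} (hn : n ≠ 0) :
    (gaussianMatrix n).real (balancedRows n)ᶜ ≤
      n * ((1 / 2) ^ n * Real.exp (n / 2) + 2 * (√2 ^ n * Real.exp (-n)) +
        2 * (√2 ^ n * Real.exp (-n))) := by
  have hrow : ∀ (k : Fin n) {s : Set (Fin n → ℂ)}, MeasurableSet s →
      (gaussianMatrix n).real {A | A k ∈ s} = (gaussianRow n).real s := fun k s hs =>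
    (measurePreserving_eval (fun _ : Fin n => gaussianRow n) k).measureReal_preimage
      hs.nullMeasurableSet
  have hsub : (balancedRows n)ᶜ ⊆ ⋃ k : Fin n, (({A | A k ∈ {h | ∑ l, ‖h l‖ ^ 2 ≤ 1 / 6}} ∪
      {A | A k ∈ {h | 4 ≤ ∑ l, ‖h l‖ ^ 2}}) ∪ {A | 4 * ∑ l, ‖A k l‖ ^ 2 <
      ∑ j ∈ Finset.univ.erase k, ‖∑ l, A j l * star (A k l)‖ ^ 2}) := by
    intro A hA
    by_contra hcon
    simp only [Set.mem_iUnion, Set.mem_union, Set.mem_ofPred_eq, not_exists, not_or, not_le,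
      not_lt] at hcon
    exact hA fun k => ⟨(hcon k).1.1, (hcon k).1.2, (hcon k).2⟩
  refine (measureReal_mono hsub).trans ((measureReal_iUnion_fintype_le _).trans ?_)
  rw [← nsmul_eq_mul]
  refine (Finset.sum_le_card_nsmul _ _ _ fun k _ => ?_).trans_eq
    (by rw [Finset.card_univ, Fintype.card_fin])
  refine (measureReal_union_le _ _).trans (add_le_add ((measureReal_union_le _ _).trans
    (add_le_add ?_ ?_)) (gaussianMatrix_cross_terms hn k))
  · rw [hrow k (measurableSet_le (by fun_prop) (by fun_prop))]
    exact gaussianRow_sum_norm_sq_le hn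
  · rw [hrow k (measurableSet_le (by fun_prop) (by fun_prop))]
    exact gaussianRow_le_sum_norm_sq hn

lemma card_singularValue_of_mem_balancedRows {n : ℕ} {A : Matrix (Fin n) (Fin n) ℂ}
    (hA : A ∈ balancedRows n) :
    (1 / 4608 : ℝ) * n ≤
      Nat.card {i // 1 / 12 ≤ singularValue A i ^ 2 ∧ singularValue A i ^ 2 ≤ 768} := by
  refine card_mem_Icc_ge_of_moments (fun i => sq_nonneg _) ?_ ?_
  · rw [sum_sq_singularValue]
    calc (n : ℝ) / 6 = ∑ _k : Fin n, (1 / 6 : ℝ) := by simp; ring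
      _ ≤ _ := Finset.sum_le_sum fun k _ => (hA k).1.le
  · rw [sum_pow_four_singularValue]
    calc _ ≤ ∑ _k : Fin n, (32 : ℝ) := Finset.sum_le_sum fun k _ => ?_
      _ = 32 * n := by simp; ring
    obtain ⟨-, h2, h3⟩ := hA k
    rw [← Finset.add_sum_erase _ _ (Finset.mem_univ k)]
    have h4 : ∑ l, A k l * star (A k l) = ((∑ l, ‖A k l‖ ^ 2 : ℝ) : ℂ) := by
      push_cast
      exact Finset.sum_congr rfl fun l _ => Complex.mul_conj' _
    have h5 : 0 ≤ ∑ l, ‖A k l‖ ^ 2 := Finset.sum_nonneg fun _ _ => sq_nonneg _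
    rw [h4, Complex.norm_real, Real.norm_eq_abs, sq_abs]
    nlinarith

/-- Almost surely no channel matrix vanishes, so that there is always a subchannel with a positive
singular value. -/
lemma ae_exists_normalizedNoise_pos {Ω : Type*} [MeasurableSpace Ω] {μ : Measure Ω}
    {H : ∀ n : ℕ, Ω → Matrix (Fin n) (Fin n) ℂ} (hH : ∀ n, IsComplexGaussianMatrix (H n) μ)
    {noiseVar : ℕ → ℝ} (hnoise : ∀ n, 0 < noiseVar n) :
    ∀ᵐ ω ∂μ, ∀ n, 1 ≤ n → ∃ i, 0 < normalizedNoise (noiseVar n) (H n ω) i := by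
  rw [ae_all_iff]
  intro n
  rcases Nat.eq_zero_or_pos n with rfl | hn
  · simp
  have hlaw := (hasLaw_re_mul_complexGaussian (1 / (n : ℝ≥0)) 1).fun_comp
    ((hH n).hasLaw ⟨0, hn⟩ ⟨0, hn⟩)
  simp only [nnnorm_one, one_pow, one_mul, mul_one] at hlaw
  have := nullSingletonClass_gaussianReal (μ := 0) (gaussian_variance_ne_zero hn.ne')
  have hne : ∀ᵐ ω ∂μ, (H n ω ⟨0, hn⟩ ⟨0, hn⟩).re ≠ 0 := by
    rw [hlaw.ae_iff (p := fun x => x ≠ 0) (measurableSet_singleton (0 : ℝ)).compl.mem]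
    exact Measure.ae_ne _ 0
  filter_upwards [hne] with ω hω _
  by_contra! hcon
  have hR : ∀ i, singularValue (H n ω) i ^ 2 = 0 := fun i => by
    by_contra h
    have h0 := lt_of_le_of_ne (sq_nonneg (singularValue (H n ω) i)) (Ne.symm h)
    refine (hcon i).not_gt ?_
    unfold normalizedNoise
    have h1 := hnoise n
    have h2 : (0 : ℝ) < n := by exact_mod_cast hn
    positivity
  have hz := sum_sq_singularValue (H n ω)
  simp_rw [hR, Finset.sum_const_zero] at hz
  have h1 := (Finset.sum_eq_zero_iff_of_nonneg fun j _ =>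
    Finset.sum_nonneg fun l _ => sq_nonneg ‖H n ω j l‖).1 hz.symm ⟨0, hn⟩ (Finset.mem_univ _)
  have h2 := (Finset.sum_eq_zero_iff_of_nonneg fun l _ => sq_nonneg ‖H n ω ⟨0, hn⟩ l‖).1 h1
    ⟨0, hn⟩ (Finset.mem_univ _)
  refine hω ?_
  rw [norm_eq_zero.1 (pow_eq_zero_iff two_ne_zero |>.1 h2), Complex.zero_re]

section Asymptotics

variable {Ω : Type*} [MeasurableSpace Ω] {μ : Measure Ω} [IsProbabilityMeasure μ]
  {H : ∀ n : ℕ, Ω → Matrix (Fin n) (Fin n) ℂ}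

lemma ae_eventually_mem_balancedRows (hH : ∀ n, IsComplexGaussianMatrix (H n) μ) :
    ∀ᵐ ω ∂μ, ∀ᶠ n in atTop, H n ω ∈ balancedRows n := by
  have he := Real.exp_one_gt_d9
  have hs2 : √2 < 1.5 := (Real.sqrt_lt' (by norm_num)).2 (by norm_num)
  -- the two decay rates
  have hr₁ : ‖1 / 2 * Real.exp (1 / 2)‖ < 1 := by
    rw [Real.norm_of_nonneg (by positivity)]
    have h1 : Real.exp (1 / 2) ^ 2 = Real.exp 1 := by
      rw [← Real.exp_nat_mul]
      norm_num
    have h2 := Real.exp_one_lt_d9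
    nlinarith [Real.exp_pos (1 / 2)]
  have hr₂ : ‖√2 * Real.exp (-1)‖ < 1 := by
    rw [Real.norm_of_nonneg (by positivity), Real.exp_neg, ← div_eq_mul_inv,
      div_lt_one (Real.exp_pos 1)]
    linarith
  have hsum := ((summable_pow_mul_geometric_of_norm_lt_one 1 hr₁).add
    ((summable_pow_mul_geometric_of_norm_lt_one 1 hr₂).mul_left 4))
  have := ae_eventually_notMem_of_summable (μ := μ)
    (s := fun n => {ω | n ≠ 0 ∧ H n ω ∈ (balancedRows n)ᶜ}) hsum fun n => by
      rcases eq_or_ne n 0 with rfl | hn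
      · simp
      refine (measureReal_mono (s₂ := {ω | H n ω ∈ (balancedRows n)ᶜ}) fun ω h => h.2).trans ?_
      refine (measureReal_preimage_le_gaussianMatrix (hH n) _).trans
        ((gaussianMatrix_compl_balancedRows hn).trans_eq ?_)
      have e1 : Real.exp (n / 2) = Real.exp (1 / 2) ^ n := by
        rw [← Real.exp_nat_mul]
        ring_nf
      have e2 : Real.exp (-n) = Real.exp (-1) ^ n := by
        rw [← Real.exp_nat_mul]
        ring_nf
      rw [e1, e2, mul_pow, mul_pow]
      ring
  filter_upwards [this] with ω hω
  filter_upwards [hω, eventually_ne_atTop 0] with n hn hn0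
  by_contra h
  exact hn ⟨hn0, h⟩

lemma ae_eventually_mem_smallOnSubspace (hH : ∀ n, IsComplexGaussianMatrix (H n) μ) {K : ℕ}
    (hK : 0 < K) {c : ℝ} (hc : 0 < c) :
    ∀ᵐ ω ∂μ, ∀ᶠ n in atTop, H n ω ∈ smallOnSubspace n K c := by
  have hr : Real.exp (-(c / K / 4)) < 1 := by
    rw [Real.exp_lt_one_iff, neg_lt_zero]
    positivity
  have hsum := (summable_geometric_of_lt_one (Real.exp_pos _).le hr).mul_left
    (K * (2 * √2 ^ K))
  have := ae_eventually_notMem_of_summable (μ := μ)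
    (s := fun n => {ω | K ≤ n ∧ H n ω ∈ (smallOnSubspace n K c)ᶜ}) hsum fun n => by
      rcases lt_or_ge n K with h | h
      · simp only [not_le.2 h, false_and, Set.ofPred_false, measureReal_empty]
        positivity
      refine (measureReal_mono (s₂ := {ω | H n ω ∈ (smallOnSubspace n K c)ᶜ})
        fun ω h => h.2).trans ?_
      refine (measureReal_preimage_le_gaussianMatrix (hH n) _).trans
        ((gaussianMatrix_compl_smallOnSubspace (hK.trans_le h).ne' h hc.le).trans_eq ?_)
      have e1 : Real.exp (-(n * (c / K) / 4)) = Real.exp (-(c / K / 4)) ^ n := by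
        rw [← Real.exp_nat_mul]
        ring_nf
      rw [e1]
      ring
  filter_upwards [this] with ω hω
  filter_upwards [hω, eventually_ge_atTop K] with n hn hn0
  by_contra h
  exact hn ⟨hn0, h⟩

end Asymptotics

lemma le_card_of_mem_smallOnSubspace {n K : ℕ} {A : Matrix (Fin n) (Fin n) ℂ} {c : ℝ}
    (hA : A ∈ smallOnSubspace n K c) : K ≤ Nat.card {i // singularValue A i ^ 2 ≤ c} := by
  obtain ⟨v, hv, hs⟩ := hA
  refine le_card_singularValue_sq_le hv (le_of_eq_of_le ?_ hs)
  refine Finset.sum_congr rfl fun k _ => ?_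
  rw [EuclideanSpace.norm_sq_eq]
  rfl

theorem mainTheorem7 {Ω : Type*} [MeasurableSpace Ω] (μ : Measure Ω) [IsProbabilityMeasure μ]
    (H : ∀ n : ℕ, Ω → Matrix (Fin n) (Fin n) ℂ)
    (hH : ∀ n, IsComplexGaussianMatrix (H n) μ)
    (SNR : ℝ) (P noiseVar : ℕ → ℝ)
    (hP : ∀ n, 0 < P n) (hnoise : ∀ n, 0 < noiseVar n)
    (hSNR : ∀ n, P n / noiseVar n = SNR)
    (M : ∀ n : ℕ, Ω → Fin n → ℕ)
    (hM : ∀ n ω i, ∃ m : ℕ, 1 ≤ m ∧ M n ω i = 4 ^ m) :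
    ∀ᵐ ω ∂μ,
      (∀ n, 1 ≤ n → ∃! lam : ℝ,
        IsMWFMultiplier (P n) (normalizedNoise (noiseVar n) (H n ω)) (M n ω) lam) ∧
      ∃ L : ℕ∞, 0 < L ∧
        Tendsto
          (fun n : ℕ =>
            ((kOpt (mwfPower (P n) (normalizedNoise (noiseVar n) (H n ω)) (M n ω)) : ℕ) : ℕ∞))
          atTop (𝓝 L) := by
  have hSNR' : 0 < SNR := by
    rw [← hSNR 0]
    exact div_pos (hP 0) (hnoise 0)
  have hM4 : ∀ n ω i, 4 ≤ M n ω i := fun n ω i => by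
    obtain ⟨m, hm, h⟩ := hM n ω i
    rw [h]
    exact le_self_pow₀ (by norm_num) (by omega)
  obtain ⟨θ, hθ, hcount⟩ := exists_threshold_le_kOpt (δ := 1 / 4608) (a := 1 / 12) (b := 768)
    (by norm_num) (by norm_num) (by norm_num) hSNR'
  have hsmall : ∀ᵐ ω ∂μ, ∀ K : ℕ, 0 < K → ∀ᶠ n in atTop, H n ω ∈ smallOnSubspace n K θ := by
    rw [ae_all_iff]
    intro K
    rcases Nat.eq_zero_or_pos K with rfl | hK
    · simp
    · filter_upwards [ae_eventually_mem_smallOnSubspace hH hK hθ] with ω hω _ using hω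
  filter_upwards [ae_exists_normalizedNoise_pos hH hnoise, ae_eventually_mem_balancedRows hH,
    hsmall] with ω hpos hbal hsm
  have hex : ∀ n, 1 ≤ n → ∃! lam : ℝ,
      IsMWFMultiplier (P n) (normalizedNoise (noiseVar n) (H n ω)) (M n ω) lam := fun n hn =>
    existsUnique_isMWFMultiplier (hP n)
      (fun i => div_nonneg (hnoise n).le (by positivity)) (hpos n hn) (hM4 n ω)
  refine ⟨hex, ⊤, ENat.top_pos, ?_⟩
  rw [ENat.tendsto_nhds_top_iff_natCast_lt]
  intro K
  filter_upwards [hbal, hsm (K + 1) K.succ_pos, eventually_ge_atTop 1] with n hb hs hn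
  have := hcount n (P n) (noiseVar n) (H n ω) (M n ω) hn (hnoise n) (hSNR n) (hM4 n ω) (hex n hn)
    (card_singularValue_of_mem_balancedRows hb)
  have h2 := le_card_of_mem_smallOnSubspace hs
  exact_mod_cast (by omega : K < kOpt (mwfPower (P n) (normalizedNoise (noiseVar n) (H n ω))
    (M n ω)))
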